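/- Let $X$ be a complex Banach space and let $Q$ be a bounded linear operator on $X$ that is quasinilpotent, i.e. $\sigma(Q)=\{0\}$. Define the following subsets of $\mathbb C$: $$\mathcal B_Q=\Big\{z:\ \sup_{j\ge 1}\|(1+zQ)^j\|<\infty\Big\},\qquad \mathcal G_Q=\Big\{z:\ \limsup_{t\to+\infty}\|e^{tzQ}\|<\infty\Big\},$$ $$\mathcal K_Q=\Big\{z:\ \sup_{\operatorname{Re}s>-1/2}(|s+1|-|s|)\,\|(1-szQ)^{-1}\|<\infty\Big\},$$ $$\mathcal K_Q^\infty=\Big\{z:\ \sup_{\operatorname{Re}s>-1/2,\ k\ge 1}(|s+1|-|s|)^k\,\|(1-szQ)^{-k}\|<\infty\Big\},$$ $$\mathcal R_Q=\Big\{z:\ \sup_{\operatorname{Re}s>-1/2}\|(1-szQ)^{-1}\|<\infty\Big\},$$ where $s$ ranges over complex numbers and $j,k$ over integers. Write $A^\circ$, $\overline A$ and $\partial A$ for the interior, closure and boundary of $A\subset\mathbb C$. Then $$\mathcal R_Q=\mathcal B_Q^\circ\cup\{0\}=\mathcal G_Q^\circ\cup\{0\}=\mathcal K_Q^\circ\cup\{0\}=(\mathcal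 K_Q^\infty)^\circ\cup\{0\}.$$ If moreover $\mathcal R_Q\neq\{0\}$, then $$\overline{\mathcal B_Q}=\overline{\mathcal G_Q}=\overline{\mathcal K_Q^\infty}=\overline{\mathcal R_Q}\qquad\text{and}\qquad \partial\mathcal B_Q=\partial\mathcal G_Q=\partial\mathcal K_Q^\infty=\partial\mathcal R_Q.$$ -/

import Mathlib

open Filter

noncomputable section

namespace Microspectral

variable {X : Type*} [NormedAddCommGroup X] [NormedSpace ℂ X]

/-- The operator `(1 - w Q)⁻¹`. If `σ(Q) = {0}`, then `1 - w Q` is invertible in the algebra of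
bounded operators for every `w : ℂ`, and `Ring.inverse` is its two-sided inverse. -/
def res (Q : X →L[ℂ] X) (w : ℂ) : X →L[ℂ] X :=
  Ring.inverse (1 - w • Q)

/-- The power-bounded set `B_Q`: all `z` such that `sup_{j ≥ 1} ‖(1 + z Q)^j‖ < ∞`. -/
def powerBoundedSet (Q : X →L[ℂ] X) : Set ℂ :=
  {z | ∃ N : ℝ, ∀ j : ℕ, 1 ≤ j → ‖(1 + z • Q) ^ j‖ ≤ N}

/-- The Hille–Yosida set `G_Q`: all `z` such that `limsup_{t → +∞} ‖e^{t z Q}‖ < ∞`; the limsup is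
taken in `[0, ∞]`. -/
def hilleYosidaSet (Q : X →L[ℂ] X) : Set ℂ :=
  {z | limsup (fun t : ℝ => ‖NormedSpace.exp (((t : ℂ) * z) • Q)‖ₑ) atTop < ⊤}

/-- The Kreiss set `K_Q`: all `z` such that
`sup_{Re s > -1/2} (|s + 1| - |s|) ‖(1 - s z Q)⁻¹‖ < ∞`. -/
def kreissSet (Q : X →L[ℂ] X) : Set ℂ :=
  {z | ∃ M : ℝ, ∀ s : ℂ, -(1 / 2 : ℝ) < s.re →
    (‖s + 1‖ - ‖s‖) * ‖res Q (s * z)‖ ≤ M}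

/-- The iterated Kreiss set `K_Q^∞`: all `z` such that
`sup_{Re s > -1/2, k ≥ 1} (|s + 1| - |s|)^k ‖(1 - s z Q)^{-k}‖ < ∞`. -/
def iteratedKreissSet (Q : X →L[ℂ] X) : Set ℂ :=
  {z | ∃ M : ℝ, ∀ s : ℂ, -(1 / 2 : ℝ) < s.re → ∀ k : ℕ, 1 ≤ k →
    (‖s + 1‖ - ‖s‖) ^ k * ‖res Q (s * z) ^ k‖ ≤ M}

/-- The Ritt set `R_Q`: all `z` such that `sup_{Re s > -1/2} ‖(1 - s z Q)⁻¹‖ < ∞`. -/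
def rittSet (Q : X →L[ℂ] X) : Set ℂ :=
  {z | ∃ M : ℝ, ∀ s : ℂ, -(1 / 2 : ℝ) < s.re → ‖res Q (s * z)‖ ≤ M}

end Microspectral

end

/-! All sets are squeezed between `rittSet Q` and an auxiliary set, `sectorBoundedSet Q`, where the
resolvent is bounded only on sectors strictly inside the right half-plane. Below, R ⊆ B ⊆ K^∞ ⊆ G ∩
K: Ritt's theorem, a recursion for `T ^ j * V ^ k`, and Yosida approximation. Above, both G (Laplace
transform) and K lie in the sector set. The sandwich closes because an interior point of the sector
set can be rotated slightly both ways; the two rotated sectors cover the half-plane Re s > -1/2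
outside a disc, and on the disc the resolvent is bounded by compactness. A perturbation argument
shows that R is a neighbourhood of each of its nonzero points.

For closures, G is stable under addition and positive scaling. If r ≠ 0 lies in R and z in G, then z
+ c r is interior to G, hence in R, and tends to z as c → 0+. -/

open Topology

/-! ### Estimates in a Banach algebra: exponentials, resolvents, Ritt's theorem. -/

section BanachAlgebra

variable {A : Type*} [NormedRing A] [NormedAlgebra ℂ A]

theorem exp_smul_one_eq (u : ℂ) :
    NormedSpace.exp (u • (1 : A)) = Complex.exp u • (1 : A) := by
  rw [← Algebra.algebraMap_eq_smul_one, ← NormedSpace.algebraMap_exp_comm,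
    ← Complex.exp_eq_exp_ℂ, Algebra.algebraMap_eq_smul_one]

/-- If `V` is an inverse of `x - y T` with `|y| < |x|`, and all `T ^ j * B` are bounded by `C`, then
all `T ^ j * (B * V)` are bounded by `C / (|x| - |y|)`. -/
theorem norm_pow_mul_le_of_smul_eq {T B V : A} {C : ℝ} {x y : ℂ} (hxy : ‖y‖ < ‖x‖)
    (hB : ∀ j : ℕ, ‖T ^ j * B‖ ≤ C) (hTB : Commute T B) (hV : x • V = 1 + y • (T * V)) (j : ℕ) :
    ‖T ^ j * (B * V)‖ ≤ C / (‖x‖ - ‖y‖) := by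
  -- Finiteness of the supremum `S` is needed first: the recursion gives |x| S ≤ C + |y| S, which
  -- can be solved for `S` only if `S` is finite.
  have hbdd : BddAbove (Set.range fun j : ℕ => ‖T ^ j * (B * V)‖) := by
    refine ⟨C * ‖V‖, ?_⟩
    rintro _ ⟨j, rfl⟩
    simp only
    rw [← mul_assoc]
    exact (norm_mul_le _ _).trans (by gcongr; exact hB j)
  set S := ⨆ j : ℕ, ‖T ^ j * (B * V)‖ with hS
  have hle : ∀ j : ℕ, ‖T ^ j * (B * V)‖ ≤ S := fun j => le_ciSup hbdd j
  have hrec : ∀ j : ℕ, ‖x‖ * ‖T ^ j * (B * V)‖ ≤ C + ‖y‖ * S := by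
    intro j
    have h : x • (T ^ j * (B * V)) = T ^ j * B + y • (T ^ (j + 1) * (B * V)) := by
      rw [← mul_smul_comm, ← mul_smul_comm, hV, mul_add, mul_add, mul_one, mul_smul_comm,
        mul_smul_comm, pow_succ, mul_assoc (T ^ j) T, ← mul_assoc T B V, hTB.eq, mul_assoc B T V]
    rw [← norm_smul, h]
    refine (norm_add_le _ _).trans (add_le_add (hB j) ?_)
    rw [norm_smul]
    gcongr
    exact hle _
  have hx : 0 < ‖x‖ := (norm_nonneg y).trans_lt hxy
  have hSle : S ≤ (C + ‖y‖ * S) / ‖x‖ :=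
    ciSup_le fun j => by rw [le_div_iff₀ hx, mul_comm]; exact hrec j
  rw [le_div_iff₀ hx] at hSle
  refine (hle j).trans ?_
  rw [le_div_iff₀ (by linarith)]
  linarith

variable [CompleteSpace A]

theorem exp_smul_add_smul (a b : A) (hab : Commute a b) (u v : ℂ) :
    NormedSpace.exp (u • a + v • b) = NormedSpace.exp (u • a) * NormedSpace.exp (v • b) := by
  let +nondep : NormedAlgebra ℚ A := .restrictScalars ℚ ℂ A
  exact NormedSpace.exp_add_of_commute ((hab.smul_left u).smul_right v)

theorem exp_smul_add_smul_one (a : A) (u v : ℂ) :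
    NormedSpace.exp (u • a + v • (1 : A)) = Complex.exp v • NormedSpace.exp (u • a) := by
  rw [exp_smul_add_smul a 1 (Commute.one_right a), exp_smul_one_eq, mul_smul_comm, mul_one]

/-- The exponential is a Poisson average of the powers of `B`, with weights e^{-c} c^n / n! of total
mass 1. -/
theorem norm_exp_smul_sub_one_le {B : A} {M : ℝ} (hB : ∀ k : ℕ, ‖B ^ k‖ ≤ M) {c : ℝ}
    (hc : 0 ≤ c) : ‖NormedSpace.exp ((c : ℂ) • (B - 1))‖ ≤ M := by
  have h1 : (c : ℂ) • (B - 1) = (c : ℂ) • B + (-(c : ℂ)) • (1 : A) := by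
    rw [smul_sub, neg_smul, sub_eq_add_neg]
  have h2 : ‖NormedSpace.exp ((c : ℂ) • B)‖ ≤ Real.exp c * M := by
    rw [NormedSpace.exp_eq_tsum ℂ]
    have hs : HasSum (fun n : ℕ => c ^ n / n.factorial * M) (Real.exp c * M) := by
      rw [Real.exp_eq_exp_ℝ]
      have h := (NormedSpace.exp_series_hasSum_exp' (𝕂 := ℝ) c).mul_right M
      simpa only [smul_eq_mul, div_eq_inv_mul] using h
    refine tsum_of_norm_bounded hs fun n => ?_
    rw [smul_pow, norm_smul, norm_smul]
    have : ‖((n.factorial : ℂ))⁻¹‖ * (‖(c : ℂ) ^ n‖ * ‖B ^ n‖) =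
        c ^ n / n.factorial * ‖B ^ n‖ := by
      rw [norm_inv, norm_pow, Complex.norm_real, Real.norm_of_nonneg hc, Complex.norm_natCast]
      ring
    rw [this]
    exact mul_le_mul_of_nonneg_left (hB n) (by positivity)
  rw [h1, exp_smul_add_smul_one, norm_smul, Complex.norm_exp]
  calc _ ≤ Real.exp (-(c : ℂ)).re * (Real.exp c * M) := by gcongr
    _ = M := by
      rw [← mul_assoc, ← Real.exp_add]; simp

/-- Formally V = ∫₀^∞ e^{-lt} e^{ta} dt. To avoid the improper integral, `V - V * E t` serves as the
antiderivative of `E` vanishing at 0; the mean value inequality applies on [0, T], then T → ∞. -/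
theorem norm_resolvent_le_of_exp_bounded {a V : A} {N : ℝ} {l : ℂ} (hl : 0 < l.re)
    (hN : ∀ t : ℝ, 0 ≤ t → ‖NormedSpace.exp ((t : ℂ) • a)‖ ≤ N)
    (hV : V * (l • 1 - a) = 1) : ‖V‖ ≤ N / l.re := by
  set E : ℝ → A := fun t => NormedSpace.exp ((t : ℂ) • (a - l • 1)) with hE
  have hEn : ∀ t, 0 ≤ t → ‖E t‖ ≤ N * Real.exp (-(l.re * t)) := by
    intro t ht
    have : (t : ℂ) • (a - l • 1) = (t : ℂ) • a + (-(t * l)) • (1 : A) := by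
      rw [smul_sub, smul_smul, neg_smul, sub_eq_add_neg]
    simp only [hE]
    rw [this, exp_smul_add_smul_one, norm_smul, Complex.norm_exp, mul_comm N]
    have h2 : (-((t : ℂ) * l)).re = -(l.re * t) := by simp [mul_comm]
    rw [h2]
    gcongr
    exact hN t ht
  have hd : ∀ t : ℝ, HasDerivAt (fun t => V - V * E t) (E t) t := by
    intro t
    have h1 := (hasDerivAt_exp_smul_const' (𝕂 := ℝ) (a - l • (1 : A)) t)
    have h2 : HasDerivAt E ((a - l • 1) * E t) t := by
      simpa only [hE, Complex.coe_smul] using h1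
    have h3 := (h2.const_mul V).const_sub V
    convert! h3 using 1
    rw [← mul_assoc, ← neg_mul, ← mul_neg, neg_sub, hV, one_mul]
  have hE0 : E 0 = 1 := by simp [hE]
  have key : ∀ T : ℝ, 0 ≤ T →
      ‖V‖ ≤ N / l.re + ‖V‖ * (N * Real.exp (-(l.re * T))) := by
    intro T hT
    have hb := image_norm_le_of_norm_deriv_right_le_deriv_boundary (f := fun t => V - V * E t)
      (f' := E) (a := 0) (b := T) (B := fun t => N / l.re * (1 - Real.exp (-(l.re * t))))
      (B' := fun t => N * Real.exp (-(l.re * t)))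
      (fun t _ => (hd t).continuousAt.continuousWithinAt) (fun t _ => (hd t).hasDerivWithinAt)
      (by simp [hE0]) (fun t => by
        have h := ((((hasDerivAt_id t).const_mul l.re).neg.exp).const_sub 1).const_mul (N / l.re)
        convert! h using 1
        simp only [id, Pi.neg_apply]
        field_simp) (fun t ht => hEn t ht.1) (x := T) ⟨hT, le_rfl⟩
    have hN0 : 0 ≤ N := (norm_nonneg _).trans (hN 0 le_rfl)
    have h4 : ‖V‖ ≤ ‖V - V * E T‖ + ‖V * E T‖ := by
      simpa using norm_add_le (V - V * E T) (V * E T)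
    have h5 : ‖V * E T‖ ≤ ‖V‖ * (N * Real.exp (-(l.re * T))) :=
      (norm_mul_le _ _).trans (by gcongr; exact hEn T hT)
    have h6 : N / l.re * (1 - Real.exp (-(l.re * T))) ≤ N / l.re := by
      have : 0 ≤ N / l.re := by positivity
      nlinarith [Real.exp_pos (-(l.re * T))]
    linarith
  have hlim : Tendsto (fun T : ℝ => N / l.re + ‖V‖ * (N * Real.exp (-(l.re * T)))) atTop
      (𝓝 (N / l.re + ‖V‖ * (N * 0))) := by
    refine ((Tendsto.const_mul N ?_).const_mul _).const_add _
    exact Real.tendsto_exp_neg_atTop_nhds_zero.comp (tendsto_id.const_mul_atTop hl)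
  have := ge_of_tendsto hlim ((eventually_ge_atTop 0).mono key)
  simpa using this

/-- On |w| = r the conjugate of w is r²/w, which turns the integrand into the Cauchy kernel of 1/(1
- w) at the point r². -/
theorem integral_normSq_inv_one_sub_circleMap {r : ℝ} (hr : 0 < r) (hr1 : r < 1) :
    (2 * Real.pi)⁻¹ * ∫ θ in (0 : ℝ)..2 * Real.pi, (‖1 - circleMap 0 r θ‖ ^ 2)⁻¹ =
      (1 - r ^ 2)⁻¹ := by
  have hmem : ((r ^ 2 : ℝ) : ℂ) ∈ Metric.ball (0 : ℂ) r := by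
    rw [mem_ball_zero_iff, Complex.norm_real, Real.norm_of_nonneg (by positivity)]
    nlinarith
  have hne : ∀ w ∈ Metric.closedBall (0 : ℂ) r, (1 : ℂ) - w ≠ 0 := by
    intro w hw h
    rw [mem_closedBall_zero_iff] at hw
    rw [← sub_eq_zero.mp h, norm_one] at hw
    linarith
  have hd : DiffContOnCl ℂ (fun w : ℂ => (1 - w)⁻¹) (Metric.ball 0 r) := by
    apply DifferentiableOn.diffContOnCl
    rw [closure_ball _ hr.ne']
    intro w hw
    exact ((differentiableAt_id.const_sub 1).inv (hne w hw)).differentiableWithinAt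
  have hc := hd.circleIntegral_sub_inv_smul hmem
  rw [circleIntegral] at hc
  have hint : ∀ θ : ℝ, deriv (circleMap 0 r) θ •
      ((circleMap 0 r θ - ((r ^ 2 : ℝ) : ℂ))⁻¹ • (1 - circleMap 0 r θ)⁻¹) =
      Complex.I * (((‖1 - circleMap 0 r θ‖ ^ 2)⁻¹ : ℝ) : ℂ) := by
    intro θ
    set w := circleMap 0 r θ with hw
    have hwn : ‖w‖ = r := by simp [hw, abs_of_pos hr]
    have hw1 : 1 - w ≠ 0 := hne w (by rw [mem_closedBall_zero_iff, hwn])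
    have hrw : ((r ^ 2 : ℝ) : ℂ) = w * (starRingEnd ℂ) w := by
      rw [Complex.mul_conj, Complex.normSq_eq_norm_sq, hwn]
    have hn : ((‖1 - w‖ ^ 2 : ℝ) : ℂ) = (1 - w) * (1 - (starRingEnd ℂ) w) := by
      rw [← Complex.normSq_eq_norm_sq, ← Complex.mul_conj]; simp
    have hw0 : w ≠ 0 := by rw [← norm_pos_iff, hwn]; exact hr
    have hw2 : 1 - (starRingEnd ℂ) w ≠ 0 := by
      intro h
      apply hw1
      have := congrArg (starRingEnd ℂ) h
      simpa using this
    rw [deriv_circleMap, Complex.ofReal_inv, hn, hrw, smul_eq_mul, smul_eq_mul, ← hw]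
    have : w - w * (starRingEnd ℂ) w = w * (1 - (starRingEnd ℂ) w) := by ring
    rw [this]
    field_simp
  simp_rw [hint] at hc
  rw [intervalIntegral.integral_const_mul, intervalIntegral.integral_ofReal] at hc
  have h2 : ((∫ θ in (0 : ℝ)..2 * Real.pi, (‖1 - circleMap 0 r θ‖ ^ 2)⁻¹ : ℝ) : ℂ) =
      ((2 * Real.pi * (1 - r ^ 2)⁻¹ : ℝ) : ℂ) := by
    apply mul_left_cancel₀ Complex.I_ne_zero
    rw [hc]; push_cast; rw [smul_eq_mul]; ring
  rw [Complex.ofReal_inj] at h2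
  rw [h2, ← mul_assoc, inv_mul_cancel₀ (by positivity), one_mul]

/-- Ritt's theorem, in a form with the generating function of `(n + 1) T ^ n`. -/
theorem norm_pow_le_of_norm_inverse_le {T : A} {M : ℝ}
    (hu : ∀ w : ℂ, ‖w‖ < 1 → IsUnit (1 - w • T))
    (hM : ∀ w : ℂ, ‖w‖ < 1 → ‖Ring.inverse (1 - w • T)‖ ≤ M / ‖1 - w‖) (n : ℕ) :
    ‖T ^ n‖ ≤ 2 * Real.exp 1 * M ^ 2 := by
  -- Squaring the resolvent puts a factor n + 1 on the n-th coefficient, which absorbs the growth of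
  -- the circle integral; the unsquared resolvent would lose a factor log n.
  set f : ℂ → A := fun w => Ring.inverse (1 - w • T) ^ 2 with hf
  have hfd : ∀ w : ℂ, ‖w‖ < 1 → DifferentiableAt ℂ f w := by
    intro w hw
    have h1 : DifferentiableAt ℂ (fun w : ℂ => 1 - w • T) w := by fun_prop
    exact ((differentiableAt_inverse (𝕜 := ℂ) (hu w hw)).comp w h1).pow 2
  -- This radius gives both r^{-n} ≤ e and 1/(1 - r²) ≤ n + 2.
  set r : ℝ := (n + 1) / (n + 2) with hr
  have hr0 : 0 < r := by positivity
  have hr1 : r < 1 := by rw [hr, div_lt_one (by positivity)]; linarith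
  have hser := DifferentiableOn.hasFPowerSeriesOnBall (R := ⟨r, hr0.le⟩) (c := (0 : ℂ)) (f := f)
    (fun w hw => (hfd w ((mem_closedBall_zero_iff.mp hw).trans_lt hr1)).differentiableWithinAt) hr0
  set p : FormalMultilinearSeries ℂ ℂ A := fun k =>
    ContinuousMultilinearMap.mkPiRing ℂ (Fin k) (((k : ℂ) + 1) • T ^ k) with hp
  have hser2 : HasFPowerSeriesAt f p 0 := by
    rw [hasFPowerSeriesAt_iff]
    have hev : ∀ᶠ w : ℂ in 𝓝 0, ‖w • T‖ < 1 := by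
      have : ContinuousAt (fun w : ℂ => ‖w • T‖) 0 := by fun_prop
      exact this.eventually_lt continuousAt_const (by simp)
    filter_upwards [hev] with w hw
    have := hasSum_choose_mul_geometric_of_norm_lt_one' 1 hw
    rw [zero_add]
    convert! this using 2 with k
    simp only [hp, FormalMultilinearSeries.coeff, ContinuousMultilinearMap.mkPiRing_apply]
    have hk : (((k + 1).choose 1 : ℕ) : A) = ((k : ℂ) + 1) • (1 : A) := by
      rw [Nat.choose_one_right, ← Nat.cast_succ, Nat.cast_smul_eq_nsmul, nsmul_one]
    rw [hk, smul_one_mul, smul_pow]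
    simpa using smul_comm _ _ _
  -- The Neumann expansion is known only near 0; uniqueness of power series carries it over to the
  -- Cauchy series of radius r.
  have heq := hser2.eq_formalMultilinearSeries hser.hasFPowerSeriesAt
  have hbd := norm_cauchyPowerSeries_le f 0 r n
  have hn : ‖p n‖ = (n + 1) * ‖T ^ n‖ := by
    simp only [hp]
    rw [ContinuousMultilinearMap.norm_mkPiRing, norm_smul]
    congr 1
    exact_mod_cast Complex.norm_natCast (n + 1)
  have h1 : (n + 1) * ‖T ^ n‖ ≤
      ((2 * Real.pi)⁻¹ * ∫ θ in (0 : ℝ)..2 * Real.pi, ‖f (circleMap 0 r θ)‖) * |r|⁻¹ ^ n := by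
    rw [← hn, heq]; exact hbd
  have hcirc : ∀ θ, ‖circleMap 0 r θ‖ < 1 := fun θ => by simpa [abs_of_pos hr0] using hr1
  have hcne : ∀ θ, 1 - circleMap 0 r θ ≠ 0 := fun θ h => by
    have := hcirc θ
    rw [← sub_eq_zero.mp h, norm_one] at this
    exact lt_irrefl _ this
  have h2 : (∫ θ in (0 : ℝ)..2 * Real.pi, ‖f (circleMap 0 r θ)‖) ≤
      ∫ θ in (0 : ℝ)..2 * Real.pi, M ^ 2 * (‖1 - circleMap 0 r θ‖ ^ 2)⁻¹ := by
    apply intervalIntegral.integral_mono_on (by positivity)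
    · apply Continuous.intervalIntegrable
      exact (continuous_iff_continuousAt.mpr fun θ =>
        ContinuousAt.comp (f := circleMap 0 r) (g := f) (hfd _ (hcirc θ)).continuousAt
          (continuous_circleMap 0 r).continuousAt).norm
    · apply Continuous.intervalIntegrable
      refine continuous_const.mul (Continuous.inv₀ ?_ fun θ => ?_)
      · exact ((continuous_const.sub (continuous_circleMap 0 r)).norm.pow 2)
      · exact pow_ne_zero _ (norm_ne_zero_iff.mpr (hcne θ))
    · intro θ _
      calc _ ≤ ‖Ring.inverse (1 - circleMap 0 r θ • T)‖ ^ 2 := by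
            simp only [hf, pow_two]; exact norm_mul_le _ _
        _ ≤ (M / ‖1 - circleMap 0 r θ‖) ^ 2 := by
            gcongr; exact hM _ (hcirc θ)
        _ = _ := by rw [div_pow, div_eq_mul_inv]
  rw [intervalIntegral.integral_const_mul] at h2
  have h3 : (2 * Real.pi)⁻¹ * ∫ θ in (0 : ℝ)..2 * Real.pi, ‖f (circleMap 0 r θ)‖ ≤
      M ^ 2 * (1 - r ^ 2)⁻¹ := by
    rw [← integral_normSq_inv_one_sub_circleMap hr0 hr1, mul_left_comm (M ^ 2)]
    gcongr
  have h4 : |r|⁻¹ ^ n ≤ Real.exp 1 := by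
    rw [abs_of_pos hr0]
    have : r⁻¹ ≤ Real.exp (1 / (n + 1)) := by
      have h := Real.add_one_le_exp (1 / ((n : ℝ) + 1))
      refine le_trans (le_of_eq ?_) h
      rw [hr]; field_simp; ring
    calc r⁻¹ ^ n ≤ Real.exp (1 / (n + 1)) ^ n := by gcongr
      _ = Real.exp (n * (1 / (n + 1))) := by rw [Real.exp_nat_mul]
      _ ≤ Real.exp 1 := by
        apply Real.exp_le_exp.mpr
        rw [mul_one_div, div_le_one (by positivity)]; linarith
  have h5 : (1 - r ^ 2)⁻¹ ≤ (n : ℝ) + 2 := by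
    rw [inv_le_comm₀ (by nlinarith) (by positivity)]
    have : ((n : ℝ) + 2)⁻¹ = 1 - r := by rw [hr]; field_simp; ring
    rw [this]; nlinarith
  have h6 : (n + 1) * ‖T ^ n‖ ≤ M ^ 2 * (n + 2) * Real.exp 1 :=
    h1.trans (mul_le_mul (h3.trans (by gcongr)) h4 (by positivity) (by positivity))
  have h7 : M ^ 2 * (n + 2) * Real.exp 1 ≤ (n + 1) * (2 * Real.exp 1 * M ^ 2) := by
    have : 0 ≤ Real.exp 1 * M ^ 2 * n := by positivity
    nlinarith
  exact le_of_mul_le_mul_left (h6.trans h7) (by positivity)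

end BanachAlgebra

namespace Microspectral

/-! ### The resolvent of a quasinilpotent operator and the comparison of the sets. -/

section Sets

variable {X : Type*} [NormedAddCommGroup X] [NormedSpace ℂ X] [CompleteSpace X] {Q : X →L[ℂ] X}

omit [CompleteSpace X] in
theorem isUnit_one_sub_smul (hQ : spectrum ℂ Q = {0}) (w : ℂ) : IsUnit (1 - w • Q) := by
  rcases eq_or_ne w 0 with rfl | hw
  · simp
  · have h : w⁻¹ ∉ spectrum ℂ Q := by simp [hQ, hw]
    rw [spectrum.notMem_iff, Algebra.algebraMap_eq_smul_one] at h
    have h2 : 1 - w • Q = (Units.mk0 w hw) • (w⁻¹ • 1 - Q) := by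
      rw [Units.smul_mk0, smul_sub, smul_smul, mul_inv_cancel₀ hw, one_smul]
    rw [h2]
    exact h.smul _

omit [CompleteSpace X] in
theorem res_mul (hQ : spectrum ℂ Q = {0}) (w : ℂ) : res Q w * (1 - w • Q) = 1 :=
  Ring.inverse_mul_cancel _ (isUnit_one_sub_smul hQ w)

omit [CompleteSpace X] in
theorem mul_res (hQ : spectrum ℂ Q = {0}) (w : ℂ) : (1 - w • Q) * res Q w = 1 :=
  Ring.mul_inverse_cancel _ (isUnit_one_sub_smul hQ w)

omit [CompleteSpace X] in
theorem res_zero : res Q 0 = 1 := by simp [res]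

omit [CompleteSpace X] in
theorem smul_mul_res (hQ : spectrum ℂ Q = {0}) (w : ℂ) : w • (Q * res Q w) = res Q w - 1 := by
  have := mul_res hQ w
  rw [sub_mul, one_mul, smul_mul_assoc] at this
  rw [← this]; abel

omit [CompleteSpace X] in
theorem commute_res (hQ : spectrum ℂ Q = {0}) (w : ℂ) : Commute Q (res Q w) := by
  have h : Commute Q (isUnit_one_sub_smul hQ w).unit :=
    (Commute.one_right Q).sub_right ((Commute.refl Q).smul_right w)
  rw [res, Ring.inverse_of_isUnit (isUnit_one_sub_smul hQ w)]
  exact h.units_inv_right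

theorem continuous_res (hQ : spectrum ℂ Q = {0}) : Continuous (res Q) := by
  rw [continuous_iff_continuousAt]
  intro w
  have h1 : ContinuousAt (fun w : ℂ => 1 - w • Q) w := by fun_prop
  have h2 := NormedRing.inverse_continuousAt (isUnit_one_sub_smul hQ w).unit
  exact ContinuousAt.comp (f := fun w : ℂ => 1 - w • Q) (g := Ring.inverse) h2 h1

theorem exists_norm_res_le_of_norm_le (hQ : spectrum ℂ Q = {0}) (C : ℝ) :
    ∃ M, ∀ w : ℂ, ‖w‖ ≤ C → ‖res Q w‖ ≤ M := by
  obtain ⟨M, hM⟩ := (isCompact_closedBall (0 : ℂ) C).exists_bound_of_continuousOn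
    (continuous_res hQ).continuousOn
  exact ⟨M, fun w hw => hM w (mem_closedBall_zero_iff.mpr hw)⟩

theorem norm_lt_norm_add_one {s : ℂ} (hs : -(1 / 2 : ℝ) < s.re) : ‖s‖ < ‖s + 1‖ := by
  rw [← sq_lt_sq₀ (norm_nonneg _) (norm_nonneg _), ← Complex.normSq_eq_norm_sq,
    ← Complex.normSq_eq_norm_sq, Complex.normSq_apply, Complex.normSq_apply]
  simp only [Complex.add_re, Complex.one_re, Complex.add_im, Complex.one_im]
  nlinarith

/-! ### The Ritt set -/

omit [CompleteSpace X] in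
theorem zero_mem_rittSet : (0 : ℂ) ∈ rittSet Q :=
  ⟨‖(1 : X →L[ℂ] X)‖, fun s _ => by rw [mul_zero, res_zero]⟩

/-- The substitution s = w/(1 - w) maps the unit disc into Re s > -1/2 and turns the Ritt condition
into the hypothesis of `norm_pow_le_of_norm_inverse_le`. -/
theorem rittSet_subset_powerBoundedSet (hQ : spectrum ℂ Q = {0}) :
    rittSet Q ⊆ powerBoundedSet Q := by
  rintro z ⟨M, hM⟩
  have hw : ∀ w : ℂ, ‖w‖ < 1 → 1 - w ≠ 0 := fun w hw h => by
    rw [← sub_eq_zero.mp h, norm_one] at hw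
    exact lt_irrefl _ hw
  have key : ∀ w : ℂ, ‖w‖ < 1 →
      1 - w • (1 + z • Q) = (1 - w) • (1 - (w / (1 - w) * z) • Q) := by
    intro w h
    rw [smul_sub, smul_smul, ← mul_assoc, mul_div_cancel₀ _ (hw w h), smul_add, sub_smul, one_smul,
      smul_smul]
    abel
  have hre : ∀ w : ℂ, ‖w‖ < 1 → -(1 / 2 : ℝ) < (w / (1 - w)).re := by
    intro w h
    have h1 : w / (1 - w) = (1 - w)⁻¹ - 1 := by
      have := hw w h
      field_simp; ring
    have h2 : 0 < Complex.normSq (1 - w) := Complex.normSq_pos.mpr (hw w h)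
    have h3 : Complex.normSq w < 1 := by
      rw [Complex.normSq_eq_norm_sq]; nlinarith [norm_nonneg w]
    rw [h1, Complex.sub_re, Complex.inv_re, Complex.one_re, lt_sub_iff_add_lt, lt_div_iff₀ h2]
    rw [Complex.normSq_apply] at h3 ⊢
    simp only [Complex.sub_re, Complex.one_re, Complex.sub_im, Complex.one_im]
    nlinarith
  have hunit : ∀ w : ℂ, ‖w‖ < 1 → IsUnit (1 - w • (1 + z • Q)) := by
    intro w h
    rw [key w h]
    exact (isUnit_one_sub_smul hQ _).smul (Units.mk0 _ (hw w h))
  refine ⟨2 * Real.exp 1 * M ^ 2, fun j _ => norm_pow_le_of_norm_inverse_le ?_ ?_ j⟩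
  · exact hunit
  · intro w h
    have hinv : Ring.inverse (1 - w • (1 + z • Q)) = (1 - w)⁻¹ • res Q (w / (1 - w) * z) := by
      refine left_inv_eq_right_inv (Ring.inverse_mul_cancel _ (hunit w h)) ?_
      rw [key w h, smul_mul_smul_comm, mul_inv_cancel₀ (hw w h), mul_res hQ, one_smul]
    rw [hinv, norm_smul, norm_inv, div_eq_inv_mul M]
    gcongr
    exact hM _ (hre w h)

omit [CompleteSpace X] in
-- Since szQV = V - 1 is bounded uniformly in s, replacing z by z' perturbs the resolvent with
-- relative size O(|z'/z - 1|), uniformly in s; below 1/2 it is absorbed.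
theorem rittSet_mem_nhds (hQ : spectrum ℂ Q = {0}) {z : ℂ} (hz : z ∈ rittSet Q) (hz0 : z ≠ 0) :
    rittSet Q ∈ 𝓝 z := by
  obtain ⟨M, hM⟩ := hz
  have hc : ContinuousAt (fun z' : ℂ => ‖z' / z - 1‖ * (M + ‖(1 : X →L[ℂ] X)‖)) z := by fun_prop
  have hev : ∀ᶠ z' in 𝓝 z, ‖z' / z - 1‖ * (M + ‖(1 : X →L[ℂ] X)‖) < 1 / 2 :=
    hc.eventually_lt continuousAt_const (by simp [hz0])
  filter_upwards [hev] with z' hz'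
  refine ⟨2 * M, fun s hs => ?_⟩
  set V := res Q (s * z) with hV
  set V' := res Q (s * z') with hV'
  have h1 : V' = V + (z' / z - 1) • ((V - 1) * V') := by
    have e1 : (1 : X →L[ℂ] X) = V * (1 - (s * z) • Q) := (res_mul hQ _).symm
    have e2 : (1 - (s * z') • Q) * V' = 1 := mul_res hQ _
    have e3 : (1 - (s * z) • Q) = (1 - (s * z') • Q) + (z' / z - 1) • ((s * z) • Q) := by
      have : (z' / z - 1) * (s * z) = s * z' - s * z := by field_simp
      rw [smul_smul, this, sub_smul]; abel
    have e4 : V * ((s * z) • Q) = V - 1 := by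
      have := e1
      rw [mul_sub, mul_one] at this
      rw [this]; abel
    calc V' = V * (1 - (s * z) • Q) * V' := by rw [← e1, one_mul]
      _ = V * ((1 - (s * z') • Q) * V') + (z' / z - 1) • (V * ((s * z) • Q) * V') := by
        rw [e3, mul_add, add_mul, mul_smul_comm, smul_mul_assoc, mul_assoc]
      _ = _ := by rw [e2, mul_one, e4]
  have hVM : ‖V‖ ≤ M := hM s hs
  have h2 : ‖V'‖ ≤ ‖V‖ + ‖z' / z - 1‖ * ((M + ‖(1 : X →L[ℂ] X)‖) * ‖V'‖) := by
    calc ‖V'‖ = ‖V + (z' / z - 1) • ((V - 1) * V')‖ := by rw [← h1]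
      _ ≤ _ := by
        refine (norm_add_le _ _).trans ?_
        rw [norm_smul]
        gcongr
        refine (norm_mul_le _ _).trans ?_
        gcongr
        exact (norm_sub_le _ _).trans (by gcongr)
  have h3 := mul_le_mul_of_nonneg_right hz'.le (norm_nonneg V')
  linarith

/-! ### From power boundedness to the exponential -/

omit [CompleteSpace X] in
theorem powerBoundedSet_subset_iteratedKreissSet (hQ : spectrum ℂ Q = {0}) :
    powerBoundedSet Q ⊆ iteratedKreissSet Q := by
  rintro z ⟨N, hN⟩
  set T : X →L[ℂ] X := 1 + z • Q with hT
  set C := max N ‖(1 : X →L[ℂ] X)‖ with hC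
  have hTC : ∀ j : ℕ, ‖T ^ j‖ ≤ C := by
    intro j
    rcases Nat.eq_zero_or_pos j with rfl | hj
    · rw [pow_zero]; exact le_max_right _ _
    · exact (hN j hj).trans (le_max_left _ _)
  refine ⟨C, fun s hs k _ => ?_⟩
  have hpos : 0 < ‖s + 1‖ - ‖s‖ := sub_pos.mpr (norm_lt_norm_add_one hs)
  set V := res Q (s * z) with hV
  have hVeq : (s + 1) • V = 1 + s • (T * V) := by
    have h := mul_res hQ (s * z)
    rw [sub_mul, one_mul, smul_mul_assoc] at h
    rw [hT, add_mul, one_mul, smul_mul_assoc, smul_add, smul_smul, add_smul, one_smul, ← h]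
    abel
  have hcomm : Commute T V := by
    exact (Commute.one_left V).add_left ((commute_res hQ _).smul_left z)
  -- The induction on `k` must carry all powers `T ^ j`, because each resolvent factor shifts `j` by
  -- one.
  have hind : ∀ k j : ℕ, ‖T ^ j * V ^ k‖ ≤ C / (‖s + 1‖ - ‖s‖) ^ k := by
    intro k
    induction k with
    | zero => intro j; simpa using hTC j
    | succ k ih =>
      intro j
      rw [pow_succ V, pow_succ (‖s + 1‖ - ‖s‖), ← div_div]
      exact norm_pow_mul_le_of_smul_eq (norm_lt_norm_add_one hs) ih (hcomm.pow_right k) hVeq j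
  have := hind k 0
  rw [pow_zero, one_mul, le_div_iff₀ (by positivity)] at this
  linarith

omit [CompleteSpace X] in
theorem iteratedKreissSet_subset_kreissSet : iteratedKreissSet Q ⊆ kreissSet Q := by
  rintro z ⟨M, hM⟩
  exact ⟨M, fun s hs => by simpa using hM s hs 1 le_rfl⟩

omit [CompleteSpace X] in
theorem mem_hilleYosidaSet_iff {z : ℂ} : z ∈ hilleYosidaSet Q ↔
    ∃ N : ℝ, ∀ᶠ t : ℝ in atTop, ‖NormedSpace.exp (((t : ℂ) * z) • Q)‖ ≤ N := by
  constructor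
  · intro h
    obtain ⟨b, hb, hbt⟩ := exists_between (Set.mem_ofPred.mp h)
    refine ⟨b.toReal, (eventually_lt_of_limsup_lt hb).mono fun t ht => ?_⟩
    rw [← toReal_enorm]
    exact ENNReal.toReal_mono hbt.ne ht.le
  · rintro ⟨N, hN⟩
    refine lt_of_le_of_lt (limsup_le_of_le (a := ENNReal.ofReal N) ?_ ?_) ENNReal.ofReal_lt_top
    · isBoundedDefault
    · filter_upwards [hN] with t ht
      rw [← ofReal_norm]
      exact ENNReal.ofReal_le_ofReal ht

theorem exists_norm_exp_le_of_mem_hilleYosidaSet {z : ℂ} (hz : z ∈ hilleYosidaSet Q) :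
    ∃ N : ℝ, ∀ t : ℝ, 0 ≤ t → ‖NormedSpace.exp (((t : ℂ) * z) • Q)‖ ≤ N := by
  obtain ⟨N, hN⟩ := mem_hilleYosidaSet_iff.mp hz
  obtain ⟨T, hT⟩ := eventually_atTop.mp hN
  have hc : Continuous fun t : ℝ => NormedSpace.exp (((t : ℂ) * z) • Q) := by
    let +nondep : NormedAlgebra ℚ (X →L[ℂ] X) := .restrictScalars ℚ ℂ (X →L[ℂ] X)
    exact NormedSpace.exp_continuous.comp (by fun_prop)
  obtain ⟨N', hN'⟩ := (isCompact_Icc (a := (0 : ℝ)) (b := T)).exists_bound_of_continuousOn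
    hc.continuousOn
  refine ⟨max N N', fun t ht => ?_⟩
  rcases le_total t T with h | h
  · exact (hN' t ⟨ht, h⟩).trans (le_max_right _ _)
  · exact (hT t h).trans (le_max_left _ _)

/-- Yosida approximation: (V - 1)/s = zQV tends to zQ as s → 0+, where V = (1 - szQ)⁻¹. For s > 0
the Kreiss weight is 1, so the powers of V are bounded and `norm_exp_smul_sub_one_le` applies with c
= t/s. -/
theorem iteratedKreissSet_subset_hilleYosidaSet (hQ : spectrum ℂ Q = {0}) :
    iteratedKreissSet Q ⊆ hilleYosidaSet Q := by
  rintro z ⟨M, hM⟩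
  rw [mem_hilleYosidaSet_iff]
  refine ⟨max M ‖(1 : X →L[ℂ] X)‖, (eventually_ge_atTop 0).mono fun t ht => ?_⟩
  have hbound : ∀ s : ℝ, 0 < s →
      ‖NormedSpace.exp (((t / s : ℝ) : ℂ) • (res Q (s * z) - 1))‖ ≤
        max M ‖(1 : X →L[ℂ] X)‖ := by
    intro s hs
    refine norm_exp_smul_sub_one_le (fun k => ?_) (by positivity)
    rcases Nat.eq_zero_or_pos k with rfl | hk
    · rw [pow_zero]; exact le_max_right _ _
    · have h := hM s (by rw [Complex.ofReal_re]; linarith) k hk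
      have h1 : ‖(s : ℂ) + 1‖ - ‖(s : ℂ)‖ = 1 := by
        rw [← Complex.ofReal_one, ← Complex.ofReal_add, Complex.norm_real, Complex.norm_real,
          Real.norm_of_nonneg (by positivity), Real.norm_of_nonneg hs.le]
        ring
      rw [h1, one_pow, one_mul] at h
      exact h.trans (le_max_left _ _)
  have hlim : Tendsto (fun s : ℝ => NormedSpace.exp (((t : ℂ) * z) • (Q * res Q (s * z))))
      (𝓝[>] 0) (𝓝 (NormedSpace.exp (((t : ℂ) * z) • Q))) := by
    let +nondep : NormedAlgebra ℚ (X →L[ℂ] X) := .restrictScalars ℚ ℂ (X →L[ℂ] X)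
    have hs : Continuous fun s : ℝ => (s : ℂ) * z := by fun_prop
    have hc : Continuous fun s : ℝ =>
        NormedSpace.exp (((t : ℂ) * z) • (Q * res Q (s * z))) :=
      NormedSpace.exp_continuous.comp
        (Continuous.const_smul (Continuous.mul (continuous_const (y := Q))
          ((continuous_res hQ).comp hs)) ((t : ℂ) * z))
    have h0 := hc.tendsto 0
    simp only [Complex.ofReal_zero, zero_mul, res_zero, mul_one] at h0
    exact h0.mono_left nhdsWithin_le_nhds
  refine le_of_tendsto hlim.norm ?_
  filter_upwards [self_mem_nhdsWithin] with s hs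
  have hs' : (0 : ℝ) < s := hs
  convert! hbound s hs' using 3
  rw [← smul_mul_res hQ, smul_smul]
  congr 1
  have : (s : ℂ) ≠ 0 := by exact_mod_cast hs'.ne'
  push_cast
  field_simp

theorem add_mem_hilleYosidaSet {z z' : ℂ} (hz : z ∈ hilleYosidaSet Q)
    (hz' : z' ∈ hilleYosidaSet Q) : z + z' ∈ hilleYosidaSet Q := by
  rw [mem_hilleYosidaSet_iff] at *
  obtain ⟨N, hN⟩ := hz
  obtain ⟨N', hN'⟩ := hz'
  refine ⟨N * N', ?_⟩
  filter_upwards [hN, hN'] with t h h'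
  rw [mul_add, add_smul, exp_smul_add_smul _ _ (Commute.refl Q)]
  exact (norm_mul_le _ _).trans (mul_le_mul h h' (norm_nonneg _) ((norm_nonneg _).trans h))

omit [CompleteSpace X] in
theorem real_mul_mem_hilleYosidaSet {z : ℂ} (hz : z ∈ hilleYosidaSet Q) {c : ℝ} (hc : 0 < c) :
    (c : ℂ) * z ∈ hilleYosidaSet Q := by
  rw [mem_hilleYosidaSet_iff] at *
  obtain ⟨N, hN⟩ := hz
  refine ⟨N, ?_⟩
  filter_upwards [(tendsto_id.const_mul_atTop hc).eventually hN] with t ht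
  simpa [mul_comm, mul_left_comm] using ht

/-! ### Boundedness in sectors -/

/-- All `z` such that `(1 - s z Q)⁻¹` is bounded on each closed sector `c |s| ≤ Re s`, `c > 0`. -/
def sectorBoundedSet (Q : X →L[ℂ] X) : Set ℂ :=
  {z | ∀ c : ℝ, 0 < c → ∃ M : ℝ, ∀ s : ℂ, c * ‖s‖ ≤ s.re → ‖res Q (s * z)‖ ≤ M}

omit [CompleteSpace X] in
-- From (|s+1| - |s|)(|s+1| + |s|) = 1 + 2 Re s, the weight is at least (1 + 2c|s|)/(1 + 2|s|) ≥
-- min(1, c) on the sector.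
theorem kreissSet_subset_sectorBoundedSet : kreissSet Q ⊆ sectorBoundedSet Q := by
  rintro z ⟨M, hM⟩ c hc
  refine ⟨M / min 1 c, fun s hs => ?_⟩
  have hd : 0 < min 1 c := lt_min one_pos hc
  have hs0 : 0 ≤ s.re := le_trans (by positivity) hs
  have hlt := norm_lt_norm_add_one (s := s) (by linarith)
  rw [le_div_iff₀ hd, mul_comm]
  refine le_trans ?_ (hM s (by linarith))
  gcongr
  have h1 : ‖s + 1‖ ≤ ‖s‖ + 1 := by simpa using norm_add_le s 1
  have h2 : (‖s + 1‖ - ‖s‖) * (‖s + 1‖ + ‖s‖) = 1 + 2 * s.re := by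
    have e1 : ‖s + 1‖ ^ 2 = (s.re + 1) * (s.re + 1) + s.im * s.im := by
      rw [← Complex.normSq_eq_norm_sq, Complex.normSq_apply]; simp
    have e2 : ‖s‖ ^ 2 = s.re * s.re + s.im * s.im := by
      rw [← Complex.normSq_eq_norm_sq, Complex.normSq_apply]
    linarith
  have h3 : 1 + 2 * s.re ≤ (‖s + 1‖ - ‖s‖) * (1 + 2 * ‖s‖) := by
    rw [← h2]
    exact mul_le_mul_of_nonneg_left (by linarith) (by linarith)
  have h4 : min 1 c * (1 + 2 * ‖s‖) ≤ 1 + 2 * s.re := by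
    have := mul_le_mul_of_nonneg_right (min_le_right 1 c) (norm_nonneg s)
    have := min_le_left 1 c
    linarith
  exact le_of_mul_le_mul_right (h4.trans h3) (by positivity)

/-- The Laplace bound at l = 1/s, where Re l = Re s/|s|², gives N|s|/Re s ≤ N/c. -/
theorem hilleYosidaSet_subset_sectorBoundedSet (hQ : spectrum ℂ Q = {0}) :
    hilleYosidaSet Q ⊆ sectorBoundedSet Q := by
  intro z hz c hc
  obtain ⟨N, hN⟩ := exists_norm_exp_le_of_mem_hilleYosidaSet hz
  have hN0 : 0 ≤ N := (norm_nonneg _).trans (hN 0 le_rfl)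
  refine ⟨max (N / c) ‖(1 : X →L[ℂ] X)‖, fun s hs => ?_⟩
  rcases eq_or_ne s 0 with rfl | hs0
  · rw [zero_mul, res_zero]; exact le_max_right _ _
  refine le_trans ?_ (le_max_left _ _)
  have hsn : 0 < ‖s‖ := norm_pos_iff.mpr hs0
  have hre : 0 < s.re := lt_of_lt_of_le (by positivity) hs
  have hlre : (s⁻¹).re = s.re / ‖s‖ ^ 2 := by
    rw [Complex.inv_re, Complex.normSq_eq_norm_sq]
  have hl : 0 < (s⁻¹).re := by rw [hlre]; positivity
  have hV : (s • res Q (s * z)) * (s⁻¹ • 1 - z • Q) = 1 := by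
    have h := res_mul hQ (s * z)
    rw [smul_mul_assoc, ← mul_smul_comm, smul_sub, smul_smul, smul_smul, mul_inv_cancel₀ hs0,
      one_smul, h]
  have hb := norm_resolvent_le_of_exp_bounded hl
    (fun t ht => by simpa only [smul_smul] using hN t ht) hV
  rw [norm_smul, hlre, ← le_div_iff₀' hsn] at hb
  refine hb.trans ?_
  have e : N / (s.re / ‖s‖ ^ 2) / ‖s‖ = N * ‖s‖ / s.re := by field_simp
  rw [e, div_le_div_iff₀ hre hc]
  nlinarith

theorem interior_sectorBoundedSet_subset_rittSet (hQ : spectrum ℂ Q = {0}) :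
    interior (sectorBoundedSet Q) ⊆ rittSet Q := by
  intro z hz
  have hnh : sectorBoundedSet Q ∈ 𝓝 z := mem_interior_iff_mem_nhds.mp hz
  have hev : ∀ σ : ℂ, ∀ᶠ ε : ℝ in 𝓝 0, (1 + σ * ε) * z ∈ sectorBoundedSet Q := by
    intro σ
    have hc : Continuous fun ε : ℝ => (1 + σ * ε) * z := by fun_prop
    exact hc.continuousAt.eventually_mem (by simpa using hnh)
  have hev2 : ∀ᶠ ε : ℝ in 𝓝[>] 0, ε < 1 ∧ 0 < ε ∧
      (1 + Complex.I * ε) * z ∈ sectorBoundedSet Q ∧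
      (1 + (-Complex.I) * ε) * z ∈ sectorBoundedSet Q := by
    filter_upwards [nhdsWithin_le_nhds (hev Complex.I), nhdsWithin_le_nhds (hev (-Complex.I)),
      self_mem_nhdsWithin, nhdsWithin_le_nhds (Iio_mem_nhds one_pos)] with ε h1 h2 h3 h4
    exact ⟨h4, h3, h1, h2⟩
  obtain ⟨ε, hε1, hε0, hp, hm⟩ := hev2.exists
  -- Dividing s by 1 ± iε divides the real part by 1 + ε² < 2, so the aperture ε/4 in `hrot` drops
  -- to ε/8.
  obtain ⟨M₁, hM₁⟩ := hp (ε / 8) (by positivity)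
  obtain ⟨M₂, hM₂⟩ := hm (ε / 8) (by positivity)
  obtain ⟨M₀, hM₀⟩ := exists_norm_res_le_of_norm_le hQ (2 / ε * ‖z‖)
  have hrot : ∀ (σ : ℝ) (M : ℝ), σ ^ 2 = 1 →
      (∀ s : ℂ, ε / 8 * ‖s‖ ≤ s.re → ‖res Q (s * ((1 + (σ * Complex.I) * ε) * z))‖ ≤ M) →
      ∀ s : ℂ, ε / 4 * ‖s‖ ≤ s.re + σ * ε * s.im → ‖res Q (s * z)‖ ≤ M := by
    intro σ M hσ hM s hs
    set u : ℂ := 1 + (σ * Complex.I) * ε with hu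
    have hure : u.re = 1 := by simp [hu]
    have huim : u.im = σ * ε := by simp [hu]
    have hnu : Complex.normSq u = 1 + ε ^ 2 := by
      rw [Complex.normSq_apply, hure, huim]
      linear_combination ε ^ 2 * hσ
    have hnu0 : 0 < Complex.normSq u := by rw [hnu]; positivity
    have hu0 : u ≠ 0 := Complex.normSq_pos.mp hnu0
    have hun : 1 ≤ ‖u‖ := by
      have := Complex.abs_re_le_norm u
      rwa [hure, abs_one] at this
    have h := hM (s / u) ?_
    · rwa [← mul_assoc, div_mul_cancel₀ _ hu0] at h
    · have hre : (s / u).re = (s.re + σ * ε * s.im) / (1 + ε ^ 2) := by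
        rw [Complex.div_re, hnu, hure, huim]; ring
      rw [hre, norm_div, le_div_iff₀ (by positivity)]
      have : ‖s‖ / ‖u‖ ≤ ‖s‖ := div_le_self (norm_nonneg _) hun
      calc ε / 8 * (‖s‖ / ‖u‖) * (1 + ε ^ 2) ≤ ε / 8 * ‖s‖ * 2 := by
            gcongr
            nlinarith
        _ ≤ _ := by linarith
  have hr₁ := hrot 1 M₁ (by norm_num) (by simpa using hM₁)
  have hr₂ := hrot (-1) M₂ (by norm_num) (by simpa using hM₂)
  refine ⟨max M₀ (max M₁ M₂), fun s hs => ?_⟩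
  -- Beyond radius 2/ε, the possibly negative real part, at least -1/2, is outweighed by ε|Im s|;
  -- the sign of Im s selects the rotation.
  rcases le_or_gt ‖s‖ (2 / ε) with hsn | hsn
  · refine (hM₀ _ ?_).trans (le_max_left _ _)
    rw [norm_mul]
    gcongr
  · have hkey : ε / 4 * ‖s‖ ≤ s.re + ε * |s.im| := by
      have h1 := Complex.norm_le_abs_re_add_abs_im s
      have h2 : 2 < ‖s‖ * ε := by rwa [div_lt_iff₀ hε0] at hsn
      have h3 : ε / 4 * ‖s‖ ≤ ε / 4 * (|s.re| + |s.im|) := by gcongr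
      have h4 : ε * ‖s‖ ≤ ε * (|s.re| + |s.im|) := by gcongr
      have h5 : 0 ≤ ε * |s.im| := by positivity
      rcases le_total 0 s.re with h | h
      · rw [abs_of_nonneg h] at h3
        nlinarith
      · have h6 : |s.re| ≤ 1 / 2 := by rw [abs_of_nonpos h]; linarith
        have h7 : ε * |s.re| ≤ 1 / 2 := by nlinarith [abs_nonneg s.re]
        linarith
    refine le_trans ?_ (le_max_right _ _)
    rcases abs_cases s.im with ⟨h, _⟩ | ⟨h, _⟩
    · exact (hr₁ s (by rw [h] at hkey; linarith)).trans (le_max_left _ _)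
    · exact (hr₂ s (by rw [h] at hkey; linarith)).trans (le_max_right _ _)

theorem rittSet_eq_interior_union {S : Set ℂ} (hQ : spectrum ℂ Q = {0}) (h1 : rittSet Q ⊆ S)
    (h2 : S ⊆ sectorBoundedSet Q) : rittSet Q = interior S ∪ {0} := by
  apply Set.Subset.antisymm
  · intro z hz
    rcases eq_or_ne z 0 with rfl | hz0
    · exact Or.inr rfl
    · exact Or.inl (mem_interior_iff_mem_nhds.mpr (mem_of_superset (rittSet_mem_nhds hQ hz hz0) h1))
  · rintro z (hz | rfl)
    · exact interior_sectorBoundedSet_subset_rittSet hQ (interior_mono h2 hz)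
    · exact zero_mem_rittSet

theorem interior_eq_interior_rittSet {S : Set ℂ} (hQ : spectrum ℂ Q = {0}) (h1 : rittSet Q ⊆ S)
    (h2 : S ⊆ sectorBoundedSet Q) : interior S = interior (rittSet Q) :=
  Set.Subset.antisymm
    (interior_maximal ((interior_mono h2).trans (interior_sectorBoundedSet_subset_rittSet hQ))
      isOpen_interior)
    (interior_mono h1)

theorem rittSet_subset_hilleYosidaSet (hQ : spectrum ℂ Q = {0}) :
    rittSet Q ⊆ hilleYosidaSet Q :=
  (rittSet_subset_powerBoundedSet hQ).trans <|
    (powerBoundedSet_subset_iteratedKreissSet hQ).trans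
      (iteratedKreissSet_subset_hilleYosidaSet hQ)

theorem hilleYosidaSet_subset_closure_rittSet (hQ : spectrum ℂ Q = {0}) (hR : rittSet Q ≠ {0}) :
    hilleYosidaSet Q ⊆ closure (rittSet Q) := by
  obtain ⟨r, hr, hr0⟩ : ∃ r ∈ rittSet Q, r ≠ 0 := by
    by_contra! h
    exact hR (Set.Subset.antisymm h (by simpa using zero_mem_rittSet))
  intro z hz
  have hmem : ∀ c : ℝ, 0 < c → z + c * r ∈ rittSet Q := by
    intro c hc
    have hc0 : (c : ℂ) ≠ 0 := by exact_mod_cast hc.ne'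
    apply interior_sectorBoundedSet_subset_rittSet hQ
    apply interior_mono (hilleYosidaSet_subset_sectorBoundedSet hQ)
    rw [mem_interior_iff_mem_nhds]
    -- For w near z + c r, the point (w - z)/c is near r, hence in R ⊆ G; so w = z + c((w - z)/c)
    -- lies in G.
    have hcont : ContinuousAt (fun w : ℂ => (c : ℂ)⁻¹ * (w - z)) (z + c * r) := by fun_prop
    have hval : (c : ℂ)⁻¹ * (z + c * r - z) = r := by field_simp; ring
    have hev := hcont.eventually_mem (s := rittSet Q)
      (by simpa only [hval] using rittSet_mem_nhds hQ hr hr0)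
    filter_upwards [hev] with w hw
    have := add_mem_hilleYosidaSet hz
      (real_mul_mem_hilleYosidaSet (rittSet_subset_hilleYosidaSet hQ hw) hc)
    rwa [mul_inv_cancel_left₀ hc0, add_sub_cancel] at this
  have hlim : Tendsto (fun c : ℝ => z + c * r) (𝓝[>] 0) (𝓝 z) := by
    have hc : Continuous fun c : ℝ => z + c * r := by fun_prop
    have := hc.tendsto 0
    simp only [Complex.ofReal_zero, zero_mul, add_zero] at this
    exact this.mono_left nhdsWithin_le_nhds
  exact mem_closure_of_tendsto hlim (by
    filter_upwards [self_mem_nhdsWithin] with c hc using hmem c hc)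

end Sets

end Microspectral

theorem theorem4p6 {X : Type*} [NormedAddCommGroup X] [NormedSpace ℂ X] [CompleteSpace X]
    (Q : X →L[ℂ] X) (hQ : spectrum ℂ Q = {0}) :
    (Microspectral.rittSet Q = interior (Microspectral.powerBoundedSet Q) ∪ {0} ∧
      Microspectral.rittSet Q = interior (Microspectral.hilleYosidaSet Q) ∪ {0} ∧
      Microspectral.rittSet Q = interior (Microspectral.kreissSet Q) ∪ {0} ∧
      Microspectral.rittSet Q = interior (Microspectral.iteratedKreissSet Q) ∪ {0}) ∧
    (Microspectral.rittSet Q ≠ {0} →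
      (closure (Microspectral.powerBoundedSet Q) = closure (Microspectral.rittSet Q) ∧
        closure (Microspectral.hilleYosidaSet Q) = closure (Microspectral.rittSet Q) ∧
        closure (Microspectral.iteratedKreissSet Q) = closure (Microspectral.rittSet Q)) ∧
      (frontier (Microspectral.powerBoundedSet Q) = frontier (Microspectral.rittSet Q) ∧
        frontier (Microspectral.hilleYosidaSet Q) = frontier (Microspectral.rittSet Q) ∧
        frontier (Microspectral.iteratedKreissSet Q) = frontier (Microspectral.rittSet Q))) := by
  have hRB := Microspectral.rittSet_subset_powerBoundedSet hQ
  have hBI := Microspectral.powerBoundedSet_subset_iteratedKreissSet hQ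
  have hIK := Microspectral.iteratedKreissSet_subset_kreissSet (Q := Q)
  have hIG := Microspectral.iteratedKreissSet_subset_hilleYosidaSet hQ
  have hKS := Microspectral.kreissSet_subset_sectorBoundedSet (Q := Q)
  have hGS := Microspectral.hilleYosidaSet_subset_sectorBoundedSet hQ
  have hRI := hRB.trans hBI
  have hRG := hRI.trans hIG
  have hIS := hIK.trans hKS
  have hBS := hBI.trans hIS
  refine ⟨⟨Microspectral.rittSet_eq_interior_union hQ hRB hBS,
    Microspectral.rittSet_eq_interior_union hQ hRG hGS,
    Microspectral.rittSet_eq_interior_union hQ (hRI.trans hIK) hKS,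
    Microspectral.rittSet_eq_interior_union hQ hRI hIS⟩, fun hR => ?_⟩
  have hGc := Microspectral.hilleYosidaSet_subset_closure_rittSet hQ hR
  -- The density argument needs additivity of G, so only sets between R and G are treated; the
  -- interior statements above use the larger sector set and so include K.
  have hcl : ∀ S : Set ℂ, Microspectral.rittSet Q ⊆ S → S ⊆ Microspectral.hilleYosidaSet Q →
      closure S = closure (Microspectral.rittSet Q) := fun S h1 h2 =>
    Set.Subset.antisymm (closure_minimal (h2.trans hGc) isClosed_closure) (closure_mono h1)
  have hfr : ∀ S : Set ℂ, Microspectral.rittSet Q ⊆ S → S ⊆ Microspectral.hilleYosidaSet Q →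
      frontier S = frontier (Microspectral.rittSet Q) := fun S h1 h2 => by
    rw [frontier, frontier, hcl S h1 h2,
      Microspectral.interior_eq_interior_rittSet hQ h1 (h2.trans hGS)]
  exact ⟨⟨hcl _ hRB (hBI.trans hIG), hcl _ hRG subset_rfl, hcl _ hRI hIG⟩,
    ⟨hfr _ hRB (hBI.trans hIG), hfr _ hRG subset_rfl, hfr _ hRI hIG⟩⟩
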